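/- Let $k$ be a field, $G$ a group, $n$ a natural number, and $\rho$ a preorder relation on $\{1,\dots,n\}$. **Combinatorial notation.** Let $\mathcal C$ be the set of classes of the equivalence relation $i\sim j\iff(i\rho j\text{ and }j\rho i)$, with the partial order $\hat i\le\hat j\iff i\rho j$, where $\hat i$ is the class of $i$; for $\alpha\in\mathcal C$ let $m_\alpha=|\alpha|$, and let $S(\alpha)$ be the symmetric group of $\alpha\subseteq\{1,\dots,n\}$. Let $\mathcal C^1,\dots,\mathcal C^q$ be the connected components of $\mathcal C$, that is, of the undirected graph on $\mathcal C$ in which $\alpha,\beta$ are joined when one covers the other. Let $\mathrm{Aut}_0(\mathcal C)$ be the group of automorphisms $g$ of the poset $\mathcal C$ with $m_{g(\alpha)}=m_\alpha$ for all $\alpha$. For $g\in\mathrm{Aut}_0(\mathcal C)$ let $\tau_g$ be the permutation of $\{1,\dots,q\}$ with $g(\mathcal C^t)=\mathcal C^{\tau_g(t)}$, and let $\tilde g$ be the permutation of $\{1,\dots,n\}$ which maps each class $\alpha=\{i_1<\dots<i_r\}$ onto $g(\alpha)=\{j_1<\dots<j_r\}$ by $\tilde g(i_s)=j_s$. **Flags.**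 A $\rho$-flag is a $k$-vector space $V$ with a family of subspaces $(V_\alpha)_{\alpha\in\mathcal C}$ for which there is a basis $v_1,\dots,v_n$ of $V$ such that, for every $\alpha$, $\{v_i\mid\hat i\le\alpha\}$ is a basis of $V_\alpha$; call such a basis adapted. A $G$-graded $\rho$-flag is a $\rho$-flag $\mathcal F=(V,(V_\alpha)_\alpha)$ with a decomposition $V=\bigoplus_{g\in G}V_g$ for which there is an adapted basis consisting of homogeneous elements. If $v_1,\dots,v_n$ is such a homogeneous adapted basis, then $(\deg v_1,\dots,\deg v_n)\in G^n$ is called a degree tuple of $\mathcal F$. Let $\mathrm{END}(\mathcal F)$ be the algebra of all linear maps $f:V\to V$ with $f(V_\alpha)\subseteq V_\alpha$ for all $\alpha$, graded by $\mathrm{END}(\mathcal F)_\sigma=\{f\mid f(V_g)\subseteq V_{\sigma g}\text{ for all }g\in G\}$, $\sigma\in G$. **The group and its action.** $\mathrm{Aut}_0(\mathcal C)$ acts to the right on $G^q$ by $(\sigma_t)_t\leftarrow g=(\sigma_{\tau_g(t)})_t$; let $\mathrm{Aut}_0(\mathcal C)\ltimes G^q$ be the right semidirect product, with multiplication $(g\ltimes\sigma)(g'\ltimes\sigma')=gg'\ltimes(\sigma\leftarrow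 g')\sigma'$. It acts to the left on $\prod_{\alpha\in\mathcal C}S(\alpha)$, with $G^q$ acting trivially and $g\in\mathrm{Aut}_0(\mathcal C)$ sending $(\psi_\alpha)_\alpha$ to $(\psi'_\alpha)_\alpha$, where $\psi'_\alpha(i)=\tilde g(\psi_{g^{-1}(\alpha)}(\tilde g^{-1}(i)))$ for $i\in\alpha$; let $\Gamma=\prod_{\alpha\in\mathcal C}S(\alpha)\rtimes(\mathrm{Aut}_0(\mathcal C)\ltimes G^q)$ be the left semidirect product, with multiplication $(\psi\rtimes x)(\psi'\rtimes x')=\psi\,(x\cdot\psi')\rtimes xx'$. The group $\Gamma$ acts to the right on the set $G^n$ by $$(h_i)_i\leftarrow(\psi\rtimes(g\ltimes\sigma))=(((h_i)_i\leftarrow\psi)\leftarrow g)\leftarrow\sigma,$$ where $(h_i)_i\leftarrow\psi=(h_{\psi_{\hat i}(i)})_i$, $(h_i)_i\leftarrow g=(h_{\tilde g(i)})_i$, and $(h_i)_i\leftarrow\sigma=(h_i\sigma_{p(i)})_i$ with $p(i)$ defined by $\hat i\in\mathcal C^{p(i)}$. **Theorem.** The isomorphism types of the $G$-graded algebras $\mathrm{END}(\mathcal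 F)$, where $\mathcal F$ is a $G$-graded $\rho$-flag, are classified by the orbits of this right action of $\Gamma$ on $G^n$. Precisely: 1. If $\mathcal F$ and $\mathcal F'$ are $G$-graded $\rho$-flags with degree tuples $h$ and $h'$, respectively, then $\mathrm{END}(\mathcal F)$ and $\mathrm{END}(\mathcal F')$ are isomorphic as $G$-graded algebras if and only if $h$ and $h'$ lie in the same orbit. 2. Every $G$-graded $\rho$-flag has a degree tuple. 3. Every element of $G^n$ is a degree tuple of some $G$-graded $\rho$-flag (on the space $k^n$). -/

import Mathlib

namespace RhoFlag

noncomputable section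

open MulOpposite

/-! ### The poset of classes of a preorder on `{1, …, n}` -/

/-- The set `C` of classes of the relation `i ∼ j ↔ (i ρ j and j ρ i)`. The preorder `ρ` is passed
explicitly: the usual order of `Fin n` is needed as well. -/
def Classes {n : ℕ} (ρ : Preorder (Fin n)) : Type :=
  @Antisymmetrization (Fin n) ρ.le (@instIsPreorderLe _ ρ)

/-- The partial order on `C` with `cls i ≤ cls j ↔ i ρ j`. -/
instance {n : ℕ} (ρ : Preorder (Fin n)) : PartialOrder (Classes ρ) :=
  @instPartialOrderAntisymmetrization (Fin n) ρ

/-- The class of `i`. -/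
def cls {n : ℕ} (ρ : Preorder (Fin n)) (i : Fin n) : Classes ρ :=
  @toAntisymmetrization (Fin n) ρ.le (@instIsPreorderLe _ ρ) i

theorem cls_le_cls {n : ℕ} (ρ : Preorder (Fin n)) (i j : Fin n) :
    cls ρ i ≤ cls ρ j ↔ ρ.le i j := Iff.rfl

open Classical in
/-- The class `α`, as a finite subset of `Fin n`. -/
def members {n : ℕ} {ρ : Preorder (Fin n)} (α : Classes ρ) : Finset (Fin n) :=
  Finset.univ.filter (fun i => cls ρ i = α)

theorem mem_members {n : ℕ} {ρ : Preorder (Fin n)} {α : Classes ρ} {i : Fin n} :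
    i ∈ members α ↔ cls ρ i = α := by
  simp [members]

/-- The number `m_α` of elements of `α`. -/
def classCard {n : ℕ} {ρ : Preorder (Fin n)} (α : Classes ρ) : ℕ := (members α).card

/-- The group `Aut₀(C)` of poset automorphisms `g` of `C` with `m_{g(α)} = m_α`. -/
def Aut0 {n : ℕ} (ρ : Preorder (Fin n)) : Subgroup (Classes ρ ≃o Classes ρ) where
  carrier := {g | ∀ α, classCard (g α) = classCard α}
  mul_mem' {g h} hg hh α := (hg (h α)).trans (hh α)
  one_mem' _ := rfl
  inv_mem' {g} hg α := by
    have h := hg (g⁻¹ α)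
    rw [show g (g⁻¹ α) = α from g.apply_symm_apply α] at h
    exact h.symm

/-! ### The permutation `g̃` of `{1, …, n}` attached to `g ∈ Aut₀(C)` -/

/-- `i` corresponds to its class `α`, together with the place of `i` in the increasing enumeration
of `α`. -/
def placeEquiv {n : ℕ} (ρ : Preorder (Fin n)) : Fin n ≃ Σ α : Classes ρ, Fin (classCard α) where
  toFun i := ⟨cls ρ i, ((members (cls ρ i)).orderIsoOfFin rfl).symm ⟨i, mem_members.2 rfl⟩⟩
  invFun x := ((members x.1).orderIsoOfFin rfl x.2 : Fin n)
  left_inv i := by simp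
  right_inv := by
    rintro ⟨α, s⟩
    have key : ∀ (i : Fin n) (hi : i ∈ members α),
        (⟨cls ρ i, ((members (cls ρ i)).orderIsoOfFin rfl).symm ⟨i, mem_members.2 rfl⟩⟩ :
          Σ α : Classes ρ, Fin (classCard α)) =
        ⟨α, ((members α).orderIsoOfFin rfl).symm ⟨i, hi⟩⟩ := by
      intro i hi
      obtain rfl := mem_members.1 hi
      rfl
    refine (key _ ((members α).orderIsoOfFin rfl s).2).trans ?_
    exact congrArg (Sigma.mk α) (OrderIso.symm_apply_apply _ s)

/-- `g` acts on pairs (class, place) by `(α, s) ↦ (g(α), s)`. -/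
def placeMap {n : ℕ} {ρ : Preorder (Fin n)} (g : Aut0 ρ) :
    (Σ α : Classes ρ, Fin (classCard α)) ≃ Σ α : Classes ρ, Fin (classCard α) :=
  Equiv.sigmaCongr g.1.toEquiv (fun α => finCongr (g.2 α).symm)

theorem placeMap_mul {n : ℕ} {ρ : Preorder (Fin n)} (g h : Aut0 ρ)
    (x : Σ α : Classes ρ, Fin (classCard α)) :
    placeMap (g * h) x = placeMap g (placeMap h x) := rfl

/-- The permutation `g̃`: if `α = {i₁ < ⋯ < i_r}` and `g(α) = {j₁ < ⋯ < j_r}`, then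
`g̃(i_s) = j_s`. The map `g ↦ g̃` is a group morphism. -/
def tilde {n : ℕ} (ρ : Preorder (Fin n)) : Aut0 ρ →* Equiv.Perm (Fin n) where
  toFun g := (placeEquiv ρ).trans ((placeMap g).trans (placeEquiv ρ).symm)
  map_one' := by
    ext i
    change ((placeEquiv ρ).symm (placeEquiv ρ i) : ℕ) = i
    simp
  map_mul' g h := by
    ext i
    simp [placeMap_mul]

theorem cls_placeEquiv_symm {n : ℕ} {ρ : Preorder (Fin n)}
    (x : Σ α : Classes ρ, Fin (classCard α)) : cls ρ ((placeEquiv ρ).symm x) = x.1 :=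
  mem_members.1 ((members x.1).orderIsoOfFin rfl x.2).2

theorem cls_tilde {n : ℕ} {ρ : Preorder (Fin n)} (g : Aut0 ρ) (i : Fin n) :
    cls ρ (tilde ρ g i) = g.1 (cls ρ i) :=
  cls_placeEquiv_symm _

/-- `g̃` is increasing on each class. -/
theorem tilde_lt_tilde {n : ℕ} {ρ : Preorder (Fin n)} (g : Aut0 ρ) {i j : Fin n}
    (hc : cls ρ i = cls ρ j) (hij : i < j) : tilde ρ g i < tilde ρ g j := by
  have key : ∀ (α : Classes ρ) (s t : Fin (classCard α)),
      (placeEquiv ρ).symm ⟨α, s⟩ < (placeEquiv ρ).symm ⟨α, t⟩ ↔ s < t := by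
    intro α s t
    have h : ∀ s t : Fin (classCard α),
        (placeEquiv ρ).symm ⟨α, s⟩ ≤ (placeEquiv ρ).symm ⟨α, t⟩ ↔ s ≤ t := fun s t =>
      ((members α).orderIsoOfFin (rfl : _ = classCard α)).map_rel_iff (a := s) (b := t)
    rw [← not_le, ← not_le, h]
  obtain ⟨⟨α, s⟩, rfl⟩ := (placeEquiv ρ).symm.surjective i
  obtain ⟨⟨β, t⟩, rfl⟩ := (placeEquiv ρ).symm.surjective j
  rw [cls_placeEquiv_symm, cls_placeEquiv_symm] at hc
  obtain rfl : α = β := hc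
  have hst := (key α s t).1 hij
  simp only [tilde, MonoidHom.coe_mk, OneHom.coe_mk, Equiv.trans_apply, Equiv.apply_symm_apply]
  exact (key (g.1 α) _ _).2 hst

/-! ### Connected components of `C` -/

/-- The set of connected components of `C`, i.e. of the undirected graph with an edge between
`α` and `β` whenever one of them covers the other. Its cardinality is `q`, and `G ^ q` is
`Components ρ → G`. -/
def Components {n : ℕ} (ρ : Preorder (Fin n)) : Type :=
  (SimpleGraph.hasse (Classes ρ)).ConnectedComponent

/-- The component that contains `α`. -/
def comp {n : ℕ} {ρ : Preorder (Fin n)} (α : Classes ρ) : Components ρ :=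
  (SimpleGraph.hasse (Classes ρ)).connectedComponentMk α

/-- The graph automorphism given by a poset automorphism. -/
def hasseIso {n : ℕ} {ρ : Preorder (Fin n)} (g : Classes ρ ≃o Classes ρ) :
    SimpleGraph.hasse (Classes ρ) ≃g SimpleGraph.hasse (Classes ρ) where
  toEquiv := g.toEquiv
  map_rel_iff' := by
    intro a b
    simp [SimpleGraph.hasse_adj]

/-- The permutation `τ` of the components induced by `g`. -/
def compMap {n : ℕ} {ρ : Preorder (Fin n)} (g : Aut0 ρ) : Components ρ → Components ρ :=
  (hasseIso g.1).connectedComponentEquiv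

theorem compMap_comp {n : ℕ} {ρ : Preorder (Fin n)} (g : Aut0 ρ) (α : Classes ρ) :
    compMap g (comp α) = comp (g.1 α) := rfl

theorem compMap_one {n : ℕ} {ρ : Preorder (Fin n)} (t : Components ρ) :
    compMap (1 : Aut0 ρ) t = t := by
  induction t using SimpleGraph.ConnectedComponent.ind
  rfl

theorem compMap_mul {n : ℕ} {ρ : Preorder (Fin n)} (g h : Aut0 ρ) (t : Components ρ) :
    compMap (g * h) t = compMap g (compMap h t) := by
  induction t using SimpleGraph.ConnectedComponent.ind
  rfl

/-! ### Right semidirect products -/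

/-- For a right action by automorphisms of `H` on `A`, `a · h = φ (op h) a`, the right semidirect
product `H ⋉ A`, whose multiplication is `(h ⋉ b)(g ⋉ a) = hg ⋉ (b · g)a`. -/
@[ext]
structure RightSemidirect (H A : Type*) [Group H] [Group A] (φ : Hᵐᵒᵖ →* MulAut A) where
  left : H
  right : A

namespace RightSemidirect

variable {H A : Type*} [Group H] [Group A] {φ : Hᵐᵒᵖ →* MulAut A}

instance : Mul (RightSemidirect H A φ) :=
  ⟨fun x y => ⟨x.left * y.left, φ (op y.left) x.right * y.right⟩⟩

instance : One (RightSemidirect H A φ) := ⟨⟨1, 1⟩⟩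

instance : Inv (RightSemidirect H A φ) :=
  ⟨fun x => ⟨x.left⁻¹, φ (op x.left⁻¹) x.right⁻¹⟩⟩

@[simp] theorem mul_left (x y : RightSemidirect H A φ) : (x * y).left = x.left * y.left := rfl

@[simp] theorem mul_right (x y : RightSemidirect H A φ) :
    (x * y).right = φ (op y.left) x.right * y.right := rfl

@[simp] theorem one_left : (1 : RightSemidirect H A φ).left = 1 := rfl

@[simp] theorem one_right : (1 : RightSemidirect H A φ).right = 1 := rfl

@[simp] theorem inv_left (x : RightSemidirect H A φ) : x⁻¹.left = x.left⁻¹ := rfl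

@[simp] theorem inv_right (x : RightSemidirect H A φ) :
    x⁻¹.right = φ (op x.left⁻¹) x.right⁻¹ := rfl

instance : Group (RightSemidirect H A φ) :=
  Group.ofLeftAxioms
    (fun x y z => by ext <;> simp [mul_assoc])
    (fun x => by ext <;> simp)
    (fun x => by
      ext
      · simp
      · simp only [mul_right, inv_right, one_right]
        rw [← MulAut.mul_apply, ← map_mul, ← op_mul, inv_mul_cancel, op_one, map_one,
          MulAut.one_apply, inv_mul_cancel])

/-- The projection `H ⋉ A → H`. -/
def leftHom : RightSemidirect H A φ →* H where
  toFun := left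
  map_one' := rfl
  map_mul' _ _ := rfl

end RightSemidirect

/-! ### The double semidirect product `∏ S(α) ⋊ (Aut₀(C) ⋉ G^q)` -/

/-- The right action of `Aut₀(C)` on the group `G^q`: `(σ_t)_t ← g = (σ_{τ(t)})_t`. -/
def shiftAction {n : ℕ} (ρ : Preorder (Fin n)) (G : Type*) [Group G] :
    (Aut0 ρ)ᵐᵒᵖ →* MulAut (Components ρ → G) where
  toFun g :=
    { toFun := fun σ t => σ (compMap g.unop t)
      invFun := fun σ t => σ (compMap g.unop⁻¹ t)
      left_inv := fun σ => by
        funext t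
        simp [← compMap_mul, compMap_one]
      right_inv := fun σ => by
        funext t
        simp [← compMap_mul, compMap_one]
      map_mul' := fun _ _ => rfl }
  map_one' := by
    ext σ t
    exact congrArg σ (compMap_one t)
  map_mul' g h := by
    ext σ t
    exact congrArg σ (compMap_mul h.unop g.unop t)

/-- The group `Aut₀(C) ⋉ G^q`. -/
abbrev AutShift {n : ℕ} (ρ : Preorder (Fin n)) (G : Type*) [Group G] :=
  RightSemidirect (Aut0 ρ) (Components ρ → G) (shiftAction ρ G)

/-- The group `∏_{α ∈ C} S(α)`, where `S(α)` is the symmetric group of the subset `α` of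
`{1, …, n}`. -/
abbrev ClassPerm {n : ℕ} (ρ : Preorder (Fin n)) :=
  (α : Classes ρ) → Equiv.Perm {i : Fin n // cls ρ i = α}

/-- The image of `i` under `ψ_α`, where `α` is the class of `i`. -/
def ClassPerm.app {n : ℕ} {ρ : Preorder (Fin n)} (ψ : ClassPerm ρ) (i : Fin n) : Fin n :=
  (ψ (cls ρ i) ⟨i, rfl⟩ : Fin n)

theorem ClassPerm.coe_apply {n : ℕ} {ρ : Preorder (Fin n)} (ψ : ClassPerm ρ) (α : Classes ρ)
    (i : {i : Fin n // cls ρ i = α}) : (ψ α i : Fin n) = ψ.app i := by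
  obtain ⟨i, rfl⟩ := i
  rfl

theorem ClassPerm.cls_app {n : ℕ} {ρ : Preorder (Fin n)} (ψ : ClassPerm ρ) (i : Fin n) :
    cls ρ (ψ.app i) = cls ρ i :=
  (ψ (cls ρ i) ⟨i, rfl⟩).2

theorem ClassPerm.one_app {n : ℕ} {ρ : Preorder (Fin n)} (i : Fin n) :
    (1 : ClassPerm ρ).app i = i := rfl

theorem ClassPerm.mul_app {n : ℕ} {ρ : Preorder (Fin n)} (ψ χ : ClassPerm ρ) (i : Fin n) :
    (ψ * χ).app i = ψ.app (χ.app i) :=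
  ψ.coe_apply (cls ρ i) (χ (cls ρ i) ⟨i, rfl⟩)

theorem ClassPerm.ext_app {n : ℕ} {ρ : Preorder (Fin n)} {ψ χ : ClassPerm ρ}
    (h : ∀ i, ψ.app i = χ.app i) : ψ = χ := by
  funext α
  ext i
  rw [ψ.coe_apply, χ.coe_apply, h]

/-- The map `i ↦ g̃(ψ_{g⁻¹(α)}(g̃⁻¹(i)))` from `α` to `α`. -/
def conjFun {n : ℕ} {ρ : Preorder (Fin n)} (g : Aut0 ρ) (ψ : ClassPerm ρ) (α : Classes ρ)
    (i : {i : Fin n // cls ρ i = α}) : {i : Fin n // cls ρ i = α} :=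
  ⟨tilde ρ g (ψ (g⁻¹.1 α) ⟨tilde ρ g⁻¹ i, by rw [cls_tilde, i.2]⟩), by
    rw [cls_tilde, (ψ (g⁻¹.1 α) _).2]
    exact g.1.apply_symm_apply α⟩

theorem coe_conjFun {n : ℕ} {ρ : Preorder (Fin n)} (g : Aut0 ρ) (ψ : ClassPerm ρ)
    (α : Classes ρ) (i : {i : Fin n // cls ρ i = α}) :
    (conjFun g ψ α i : Fin n) = tilde ρ g (ψ.app (tilde ρ g⁻¹ i)) := by
  simp only [conjFun, ClassPerm.coe_apply]

theorem tilde_inv_tilde {n : ℕ} {ρ : Preorder (Fin n)} (g : Aut0 ρ) (i : Fin n) :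
    tilde ρ g⁻¹ (tilde ρ g i) = i := by
  simp

theorem tilde_tilde_inv {n : ℕ} {ρ : Preorder (Fin n)} (g : Aut0 ρ) (i : Fin n) :
    tilde ρ g (tilde ρ g⁻¹ i) = i := by
  simp

theorem conjFun_conjFun {n : ℕ} {ρ : Preorder (Fin n)} (g : Aut0 ρ) (ψ χ : ClassPerm ρ)
    (h : ψ * χ = 1) (α : Classes ρ) (i : {i : Fin n // cls ρ i = α}) :
    conjFun g ψ α (conjFun g χ α i) = i := by
  apply Subtype.ext
  rw [coe_conjFun, coe_conjFun, tilde_inv_tilde, ← ClassPerm.mul_app, h, ClassPerm.one_app,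
    tilde_tilde_inv]

/-- The family `g → (ψ_α)_α = (ψ'_α)_α` with `ψ'_α(i) = g̃(ψ_{g⁻¹(α)}(g̃⁻¹(i)))` for `i ∈ α`. -/
def conjPerm {n : ℕ} {ρ : Preorder (Fin n)} (g : Aut0 ρ) (ψ : ClassPerm ρ) : ClassPerm ρ :=
  fun α =>
    { toFun := conjFun g ψ α
      invFun := conjFun g ψ⁻¹ α
      left_inv := conjFun_conjFun g ψ⁻¹ ψ (inv_mul_cancel ψ) α
      right_inv := conjFun_conjFun g ψ ψ⁻¹ (mul_inv_cancel ψ) α }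

theorem conjPerm_app {n : ℕ} {ρ : Preorder (Fin n)} (g : Aut0 ρ) (ψ : ClassPerm ρ) (i : Fin n) :
    (conjPerm g ψ).app i = tilde ρ g (ψ.app (tilde ρ g⁻¹ i)) :=
  coe_conjFun g ψ _ _

theorem conjPerm_one {n : ℕ} {ρ : Preorder (Fin n)} (ψ : ClassPerm ρ) : conjPerm 1 ψ = ψ := by
  refine ClassPerm.ext_app fun i => ?_
  rw [conjPerm_app]
  simp

theorem conjPerm_mul {n : ℕ} {ρ : Preorder (Fin n)} (g h : Aut0 ρ) (ψ : ClassPerm ρ) :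
    conjPerm (g * h) ψ = conjPerm g (conjPerm h ψ) := by
  refine ClassPerm.ext_app fun i => ?_
  simp only [conjPerm_app]
  simp

/-- The left action of `Aut₀(C)` on the group `∏_{α ∈ C} S(α)`. -/
def conjAction {n : ℕ} (ρ : Preorder (Fin n)) : Aut0 ρ →* MulAut (ClassPerm ρ) where
  toFun g :=
    { toFun := conjPerm g
      invFun := conjPerm g⁻¹
      left_inv := fun ψ => by rw [← conjPerm_mul, inv_mul_cancel, conjPerm_one]
      right_inv := fun ψ => by rw [← conjPerm_mul, mul_inv_cancel, conjPerm_one]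
      map_mul' := fun ψ χ => by
        refine ClassPerm.ext_app fun i => ?_
        simp only [conjPerm_app, ClassPerm.mul_app, tilde_inv_tilde] }
  map_one' := by
    ext1 ψ
    exact conjPerm_one ψ
  map_mul' g h := by
    ext1 ψ
    exact conjPerm_mul g h ψ

/-- The double semidirect product `∏_{α ∈ C} S(α) ⋊ (Aut₀(C) ⋉ G^q)`, where `1 ⋉ G^q` acts
trivially on `∏_{α ∈ C} S(α)`. -/
abbrev DoubleProduct {n : ℕ} (ρ : Preorder (Fin n)) (G : Type*) [Group G] :=
  ClassPerm ρ ⋊[(conjAction ρ).comp RightSemidirect.leftHom] AutShift ρ G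

/-! ### The right action on `G^n` -/

/-- `(h_i)_i ← (ψ_α)_α = (h_{ψ_α(i)})_i`, where `α` is the class of `i`. -/
def actPerm {n : ℕ} {ρ : Preorder (Fin n)} {G : Type*} (h : Fin n → G) (ψ : ClassPerm ρ) :
    Fin n → G := fun i => h (ψ.app i)

/-- `(h_i)_i ← g = (h_{g̃(i)})_i`. -/
def actAut {n : ℕ} {ρ : Preorder (Fin n)} {G : Type*} (h : Fin n → G) (g : Aut0 ρ) :
    Fin n → G := fun i => h (tilde ρ g i)

/-- `(h_i)_i ← (σ_t)_t = (h_i σ_p)_i`, where `p` is the component of the class of `i`. -/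
def actShift {n : ℕ} {ρ : Preorder (Fin n)} {G : Type*} [Group G] (h : Fin n → G)
    (σ : Components ρ → G) : Fin n → G := fun i => h i * σ (comp (cls ρ i))

/-- `h ← (ψ ⋊ (g ⋉ σ)) = ((h ← ψ) ← g) ← σ`. -/
def act {n : ℕ} {ρ : Preorder (Fin n)} {G : Type*} [Group G] (h : Fin n → G)
    (x : DoubleProduct ρ G) : Fin n → G :=
  actShift (actAut (actPerm h x.left) x.right.left) x.right.right

/-- The right action of the double semidirect product on `G^n` (a left action of its opposite
group). -/
instance tupleAction {n : ℕ} (ρ : Preorder (Fin n)) (G : Type*) [Group G] :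
    MulAction (DoubleProduct ρ G)ᵐᵒᵖ (Fin n → G) where
  smul x h := act h x.unop
  one_smul h := by
    funext i
    change act h (1 : DoubleProduct ρ G) i = h i
    simp [act, actShift, actAut, actPerm, ClassPerm.one_app]
  mul_smul x y h := by
    funext i
    change act h (y.unop * x.unop) i = act (act h y.unop) x.unop i
    simp only [act, actShift, actAut, actPerm, SemidirectProduct.mul_left,
      SemidirectProduct.mul_right, RightSemidirect.mul_left, RightSemidirect.mul_right,
      ClassPerm.mul_app, MonoidHom.comp_apply]
    change h (y.unop.left.app ((conjPerm y.unop.right.left x.unop.left).app _)) *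
      (y.unop.right.right (compMap x.unop.right.left _) * _) = _
    rw [conjPerm_app, map_mul, Equiv.Perm.mul_apply, tilde_inv_tilde, compMap_comp,
      ← mul_assoc]
    rw [ClassPerm.cls_app, cls_tilde]

/-! ### Flags, graded flags and their endomorphism algebras -/

/-- The indexed basis `(v_i)_i` of `V` provides the `ρ`-flag structure `(V_α)_{α ∈ C}`: with
`B_α = {v_i | i ∈ α}`, the union of the `B_β` with `β ≤ α` is a basis of `V_α`, for every `α`. -/
def IsFlagBasis {n : ℕ} {ρ : Preorder (Fin n)} {k V : Type*} [Field k] [AddCommGroup V]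
    [Module k V] (W : Classes ρ → Submodule k V) (v : Module.Basis (Fin n) k V) : Prop :=
  ∀ α, W α = Submodule.span k (v '' {i | cls ρ i ≤ α})

/-- A `ρ`-flag on the vector space `V`. -/
structure Flag {n : ℕ} (ρ : Preorder (Fin n)) (k V : Type*) [Field k] [AddCommGroup V]
    [Module k V] where
  /-- The subspaces `V_α`. -/
  space : Classes ρ → Submodule k V
  exists_basis : ∃ v : Module.Basis (Fin n) k V, IsFlagBasis space v

open Classical in
/-- A `G`-graded `ρ`-flag on the vector space `V`. -/
structure GradedFlag {n : ℕ} (ρ : Preorder (Fin n)) (G k V : Type*) [Group G] [Field k]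
    [AddCommGroup V] [Module k V] extends Flag ρ k V where
  /-- The homogeneous components `V_g` of `V`. -/
  component : G → Submodule k V
  isInternal : DirectSum.IsInternal component
  exists_homogeneous_basis : ∃ v : Module.Basis (Fin n) k V,
    IsFlagBasis space v ∧ ∀ i, ∃ g, v i ∈ component g

/-- The tuple `h ∈ G^n` is the tuple of degrees of some homogeneous basis `(v_i)_i` that provides
the flag structure. -/
def GradedFlag.IsDegreeTuple {n : ℕ} {ρ : Preorder (Fin n)} {G k V : Type*} [Group G] [Field k]
    [AddCommGroup V] [Module k V] (F : GradedFlag ρ G k V) (h : Fin n → G) : Prop :=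
  ∃ v : Module.Basis (Fin n) k V, IsFlagBasis F.space v ∧ ∀ i, v i ∈ F.component (h i)

/-- The algebra `End(F)` of endomorphisms of the flag `F`. -/
def Flag.endAlg {n : ℕ} {ρ : Preorder (Fin n)} {k V : Type*} [Field k]
    [AddCommGroup V] [Module k V] (F : Flag ρ k V) : Subalgebra k (Module.End k V) where
  carrier := {f | ∀ α, ∀ x ∈ F.space α, f x ∈ F.space α}
  mul_mem' hf hg α x hx := hf α _ (hg α x hx)
  add_mem' hf hg α x hx := (F.space α).add_mem (hf α x hx) (hg α x hx)
  algebraMap_mem' c α _ hx := (F.space α).smul_mem c hx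

/-- The component `END(F)_σ` of degree `σ` of `END(F)`: all `f ∈ End(F)` with
`f(V_g) ⊆ V_{σg}` for all `g ∈ G`. -/
def GradedFlag.endComponent {n : ℕ} {ρ : Preorder (Fin n)} {G k V : Type*} [Group G] [Field k]
    [AddCommGroup V] [Module k V] (F : GradedFlag ρ G k V) (σ : G) :
    Submodule k F.toFlag.endAlg where
  carrier := {f | ∀ g, ∀ x ∈ F.component g, f.1 x ∈ F.component (σ * g)}
  add_mem' hf hf' g x hx := (F.component (σ * g)).add_mem (hf g x hx) (hf' g x hx)
  zero_mem' g _ _ := (F.component (σ * g)).zero_mem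
  smul_mem' c _ hf g x hx := (F.component (σ * g)).smul_mem c (hf g x hx)

/-- `END(F)` and `END(F')` are isomorphic as `G`-graded algebras: there is an algebra isomorphism
which maps each homogeneous component onto the component of the same degree. -/
def GradedFlag.EndIsomorphic {n : ℕ} {ρ : Preorder (Fin n)} {G k V V' : Type*} [Group G]
    [Field k] [AddCommGroup V] [Module k V] [AddCommGroup V'] [Module k V']
    (F : GradedFlag ρ G k V) (F' : GradedFlag ρ G k V') : Prop :=
  ∃ φ : F.toFlag.endAlg ≃ₐ[k] F'.toFlag.endAlg,
    ∀ σ : G, (F.endComponent σ).map φ.toLinearMap = F'.endComponent σ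

end

end RhoFlag

open RhoFlag

/-! In a homogeneous adapted basis with degree tuple `h`, `END(F)` is the algebra of matrices
supported on `ρ`, and the matrix unit at `(i, j)`, where `i ρ j`, is homogeneous of degree `h i * (h
j)⁻¹`. These data do not change under permutations of the indices preserving `ρ`, nor under right
multiplication of `h` by a function constant on components. Such permutations are exactly the
products of class permutations with some `g̃`, so one orbit gives one isomorphism type.

Conversely, an isomorphism `φ` sends the diagonal matrix units of `F` to `n` orthogonal nonzero
idempotents of degree one. These are the diagonal units of a homogeneous basis `w` of `V'`, and
compression by them makes `φ` of each matrix unit a nonzero multiple of the corresponding unit of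
`w` (`exists_basis_of_algEquiv`). So the degrees `d` of `w` satisfy `d i * (d j)⁻¹ = h i * (h j)⁻¹`
whenever `i ρ j`, and `d` differs from `h` by a shift. It remains to compare `w` with an adapted
homogeneous basis of `F'`: both present the same algebra as the matrices supported on `ρ`, and
`exists_perm_of_support_eq` gives an automorphism of `ρ` matching them along nonzero coordinates,
which forces equal degrees. -/

namespace RhoFlag

/-! ### Endomorphisms and degrees in matrix entries -/

section Entries

variable {k : Type*} [Field k] {G : Type*} [Group G] {n : ℕ} {ρ : Preorder (Fin n)}
  {V : Type*} [AddCommGroup V] [Module k V]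

theorem mem_span_image_iff (v : Module.Basis (Fin n) k V) (p : Fin n → Prop) (x : V) :
    x ∈ Submodule.span k (v '' {i | p i}) ↔ ∀ i, v.repr x i ≠ 0 → p i := by
  rw [v.mem_span_image]
  simp [Set.subset_def]

theorem IsFlagBasis.mem_iff {W : Classes ρ → Submodule k V} {v : Module.Basis (Fin n) k V}
    (hv : IsFlagBasis W v) (α : Classes ρ) (x : V) :
    x ∈ W α ↔ ∀ i, v.repr x i ≠ 0 → cls ρ i ≤ α := by
  rw [hv α, mem_span_image_iff]

-- Split `x` in `V_g` into its coordinates of degree `g` and the others. The second part lies in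
-- `V_g` and in the sum of the other components, so independence kills it.
open Classical in
theorem component_eq_span {F : GradedFlag ρ G k V} {v : Module.Basis (Fin n) k V}
    {h : Fin n → G} (hd : ∀ i, v i ∈ F.component (h i)) (g : G) :
    F.component g = Submodule.span k (v '' {i | h i = g}) := by
  apply le_antisymm
  · intro x hx
    set y := ∑ i with h i = g, v.repr x i • v i with hy
    set z := ∑ i with ¬ h i = g, v.repr x i • v i with hz
    have hxyz : y + z = x := by
      rw [hy, hz, Finset.sum_filter_add_sum_filter_not]
      exact v.sum_repr x
    have hyg : y ∈ Submodule.span k (v '' {i | h i = g}) := by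
      refine Submodule.sum_mem _ fun i hi => Submodule.smul_mem _ _ (Submodule.subset_span ?_)
      exact ⟨i, (Finset.mem_filter.1 hi).2, rfl⟩
    have hyc : y ∈ F.component g := by
      refine Submodule.sum_mem _ fun i hi => Submodule.smul_mem _ _ ?_
      rw [← (Finset.mem_filter.1 hi).2]
      exact hd i
    have hzc : z ∈ F.component g := by
      rw [show z = x - y by rw [← hxyz]; abel]
      exact Submodule.sub_mem _ hx hyc
    have hzo : z ∈ ⨆ g' ≠ g, F.component g' := by
      refine Submodule.sum_mem _ fun i hi => Submodule.smul_mem _ _ ?_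
      exact Submodule.mem_iSup_of_mem (h i)
        (Submodule.mem_iSup_of_mem (Finset.mem_filter.1 hi).2 (hd i))
    have hz0 : z = 0 :=
      Submodule.disjoint_def.1 (F.isInternal.submodule_iSupIndep g) z hzc hzo
    rw [← hxyz, hz0, add_zero]
    exact hyg
  · rw [Submodule.span_le]
    rintro _ ⟨i, rfl, rfl⟩
    exact hd i

theorem mem_component_iff {F : GradedFlag ρ G k V} {v : Module.Basis (Fin n) k V}
    {h : Fin n → G} (hd : ∀ i, v i ∈ F.component (h i)) (g : G) (x : V) :
    x ∈ F.component g ↔ ∀ i, v.repr x i ≠ 0 → h i = g := by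
  rw [component_eq_span hd, mem_span_image_iff]

/-- Column `j` of `f` is `f (v j)`, and `v j` lies in the subspace of its own class. Transitivity of
the order on classes gives the converse. -/
theorem mem_endAlg_iff {F : Flag ρ k V} {v : Module.Basis (Fin n) k V}
    (hv : IsFlagBasis F.space v) (f : Module.End k V) :
    f ∈ F.endAlg ↔ ∀ i j, v.repr (f (v j)) i ≠ 0 → ρ.le i j := by
  constructor
  · intro hf i j hij
    have hj : v j ∈ F.space (cls ρ j) := by
      rw [hv]
      exact Submodule.subset_span ⟨j, le_rfl, rfl⟩
    exact (hv.mem_iff _ _).1 (hf _ _ hj) i hij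
  · intro hf α
    change F.space α ≤ (F.space α).comap f
    nth_rw 1 [hv α]
    rw [Submodule.span_le]
    rintro _ ⟨j, hj, rfl⟩
    exact (hv.mem_iff _ _).2 fun i hi => le_trans ((cls_le_cls ρ i j).2 (hf i j hi)) hj

theorem mem_endComponent_iff {F : GradedFlag ρ G k V} {v : Module.Basis (Fin n) k V}
    {h : Fin n → G} (hd : ∀ i, v i ∈ F.component (h i)) (σ : G) (f : F.toFlag.endAlg) :
    f ∈ F.endComponent σ ↔ ∀ i j, v.repr (f.1 (v j)) i ≠ 0 → h i = σ * h j := by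
  constructor
  · intro hf i j hij
    exact (mem_component_iff hd _ _).1 (hf _ _ (hd j)) i hij
  · intro hf g
    change F.component g ≤ (F.component (σ * g)).comap f.1
    rw [component_eq_span hd g, Submodule.span_le]
    rintro _ ⟨j, rfl, rfl⟩
    exact (mem_component_iff hd _ _).2 fun i hi => hf i j hi

/-- The matrix matrixUnit `v_j ↦ v_i` of a basis. -/
noncomputable def matrixUnit (v : Module.Basis (Fin n) k V) (i j : Fin n) : Module.End k V :=
  (v.coord j).smulRight (v i)

@[simp] theorem matrixUnit_apply (v : Module.Basis (Fin n) k V) (i j : Fin n) (x : V) :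
    matrixUnit v i j x = v.repr x j • v i := rfl

theorem matrixUnit_apply_basis (v : Module.Basis (Fin n) k V) (i j : Fin n) :
    matrixUnit v i j (v j) = v i := by
  simp

theorem matrixUnit_ne_zero (v : Module.Basis (Fin n) k V) (i j : Fin n) :
    matrixUnit v i j ≠ 0 := by
  intro h
  apply v.ne_zero i
  rw [← matrixUnit_apply_basis v i j, h, LinearMap.zero_apply]

theorem repr_matrixUnit_apply_ne_zero {v : Module.Basis (Fin n) k V} {i j a b : Fin n}
    (h : v.repr (matrixUnit v i j (v b)) a ≠ 0) : a = i ∧ b = j := by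
  simp only [matrixUnit_apply, map_smul, Module.Basis.repr_self, Finsupp.smul_apply, smul_eq_mul,
    ne_eq, mul_eq_zero, not_or] at h
  exact ⟨(Finsupp.single_apply_ne_zero.1 h.2).1, (Finsupp.single_apply_ne_zero.1 h.1).1.symm⟩

/-- Compression by diagonal idempotents expresses a single entry through products, a form that an
algebra isomorphism carries over. -/
theorem matrixUnit_mul_mul_matrixUnit (v : Module.Basis (Fin n) k V) (f : Module.End k V)
    (i j : Fin n) :
    matrixUnit v i i * f * matrixUnit v j j = v.repr (f (v j)) i • matrixUnit v i j := by
  ext x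
  simp [mul_comm, smul_smul]

theorem matrixUnit_mem_endAlg {F : Flag ρ k V} {v : Module.Basis (Fin n) k V}
    (hv : IsFlagBasis F.space v) {i j : Fin n} (hij : ρ.le i j) : matrixUnit v i j ∈ F.endAlg := by
  rw [mem_endAlg_iff hv]
  intro a b hab
  obtain ⟨rfl, rfl⟩ := repr_matrixUnit_apply_ne_zero hab
  exact hij

theorem matrixUnit_mem_endComponent {F : GradedFlag ρ G k V} {v : Module.Basis (Fin n) k V}
    {h : Fin n → G} (hv : IsFlagBasis F.space v) (hd : ∀ i, v i ∈ F.component (h i))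
    {i j : Fin n} (hij : ρ.le i j) :
    (⟨matrixUnit v i j, matrixUnit_mem_endAlg hv hij⟩ : F.toFlag.endAlg) ∈
      F.endComponent (h i * (h j)⁻¹) := by
  rw [mem_endComponent_iff hd]
  intro a b hab
  obtain ⟨rfl, rfl⟩ := repr_matrixUnit_apply_ne_zero hab
  simp

end Entries

/-! ### Existence of degree tuples and of flags with given degrees -/

section Existence

variable {k : Type*} [Field k] {G : Type*} [Group G] {n : ℕ} {ρ : Preorder (Fin n)}
  {V : Type*} [AddCommGroup V] [Module k V]

theorem GradedFlag.exists_isDegreeTuple (F : GradedFlag ρ G k V) :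
    ∃ h : Fin n → G, F.IsDegreeTuple h := by
  obtain ⟨v, hv, hh⟩ := F.exists_homogeneous_basis
  choose h hh using hh
  exact ⟨h, v, hv, hh⟩

open Classical in
theorem isInternal_span_fibers {G : Type*} (v : Module.Basis (Fin n) k V) (h : Fin n → G) :
    DirectSum.IsInternal fun g => Submodule.span k (v '' {i | h i = g}) := by
  apply DirectSum.isInternal_submodule_of_iSupIndep_of_iSup_eq_top
  · intro g
    have hdis : Disjoint {i | h i = g} {i | h i ≠ g} :=
      Set.disjoint_left.2 fun i hi hi' => hi' hi
    refine (v.linearIndependent.disjoint_span_image hdis).mono_right ?_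
    refine iSup₂_le fun g' hg' => Submodule.span_mono (Set.image_mono ?_)
    rintro i rfl
    exact hg'
  · rw [eq_top_iff, ← v.span_eq, Submodule.span_le]
    rintro _ ⟨i, rfl⟩
    exact Submodule.mem_iSup_of_mem (h i) (Submodule.subset_span ⟨i, rfl, rfl⟩)

/-- The graded flag for which a given basis is adapted and homogeneous of given degrees. -/
def GradedFlag.ofBasis (ρ : Preorder (Fin n)) (v : Module.Basis (Fin n) k V) (h : Fin n → G) :
    GradedFlag ρ G k V where
  space α := Submodule.span k (v '' {i | cls ρ i ≤ α})
  exists_basis := ⟨v, fun _ => rfl⟩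
  component g := Submodule.span k (v '' {i | h i = g})
  isInternal := isInternal_span_fibers v h
  exists_homogeneous_basis :=
    ⟨v, fun _ => rfl, fun i => ⟨h i, Submodule.subset_span ⟨i, rfl, rfl⟩⟩⟩

theorem GradedFlag.ofBasis_isDegreeTuple (v : Module.Basis (Fin n) k V) (h : Fin n → G) :
    (GradedFlag.ofBasis ρ v h).IsDegreeTuple h :=
  ⟨v, fun _ => rfl, fun i => Submodule.subset_span ⟨i, rfl, rfl⟩⟩

end Existence

/-! ### Tuples in one orbit give isomorphic graded algebras -/

section Conjugation

variable {k : Type*} [Field k] {G : Type*} [Group G] {n : ℕ} {ρ : Preorder (Fin n)}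
  {V V' : Type*} [AddCommGroup V] [Module k V] [AddCommGroup V'] [Module k V']

/-- Two graded flags have isomorphic endomorphism algebras if a permutation of the indices
preserves the preorder and the degrees of the matrix units. -/
theorem GradedFlag.endIsomorphic_of_perm {F : GradedFlag ρ G k V} {F' : GradedFlag ρ G k V'}
    {v : Module.Basis (Fin n) k V} {v' : Module.Basis (Fin n) k V'} {h h' : Fin n → G}
    (hv : IsFlagBasis F.space v) (hd : ∀ i, v i ∈ F.component (h i))
    (hv' : IsFlagBasis F'.space v') (hd' : ∀ i, v' i ∈ F'.component (h' i))
    (π : Equiv.Perm (Fin n)) (hπ : ∀ i j, ρ.le (π i) (π j) ↔ ρ.le i j)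
    (hh : ∀ i j, ρ.le i j → h' i * (h' j)⁻¹ = h (π i) * (h (π j))⁻¹) :
    F.EndIsomorphic F' := by
  -- `T` matches `v (π j)` with `v' j`, so conjugation by `T` moves the entry at `(π i, π j)` to
  -- `(i, j)`.
  let T : V ≃ₗ[k] V' := v.equiv v' π.symm
  have hrepr : ∀ (f : Module.End k V) (i j : Fin n),
      v'.repr (T.conjAlgEquiv k f (v' j)) i = v.repr (f (v (π j))) (π i) := by
    intro f i j
    have h1 : T.symm (v' j) = v (π j) := by
      rw [LinearEquiv.symm_apply_eq, Module.Basis.equiv_apply, Equiv.symm_apply_apply]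
    have h2 : ∀ x, v'.repr (T x) i = v.repr x (π i) := by
      intro x
      have : v'.coord i ∘ₗ T.toLinearMap = v.coord (π i) := by
        refine v.ext fun l => ?_
        simp [T, Finsupp.single_apply, Equiv.symm_apply_eq]
      exact LinearMap.congr_fun this x
    simp [LinearEquiv.conjAlgEquiv_apply, h1, h2]
  have hmap : F.toFlag.endAlg.map (T.conjAlgEquiv k : Module.End k V →ₐ[k] Module.End k V') =
      F'.toFlag.endAlg := by
    ext f
    obtain ⟨f, rfl⟩ := (T.conjAlgEquiv k).surjective f
    rw [mem_endAlg_iff hv']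
    simp only [hrepr]
    trans f ∈ F.toFlag.endAlg
    · constructor
      · rintro ⟨f', hf', hff⟩
        rwa [← (T.conjAlgEquiv k).injective hff]
      · exact fun hf => ⟨f, hf, rfl⟩
    · rw [mem_endAlg_iff hv]
      constructor
      · exact fun hf i j hij => (hπ i j).1 (hf _ _ hij)
      · intro hf i j hij
        obtain ⟨i, rfl⟩ := π.surjective i
        obtain ⟨j, rfl⟩ := π.surjective j
        exact (hπ i j).2 (hf i j hij)
  let φ : F.toFlag.endAlg ≃ₐ[k] F'.toFlag.endAlg :=
    ((T.conjAlgEquiv k).subalgebraMap F.toFlag.endAlg).trans (Subalgebra.equivOfEq _ _ hmap)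
  have hφ : ∀ f, (φ f).1 = T.conjAlgEquiv k f.1 := fun f => rfl
  refine ⟨φ, fun σ => ?_⟩
  ext f
  obtain ⟨f, rfl⟩ := φ.surjective f
  trans f ∈ F.endComponent σ
  · constructor
    · rintro ⟨f', hf', hff⟩
      rwa [← φ.injective hff]
    · exact fun hf => ⟨f, hf, rfl⟩
  · rw [mem_endComponent_iff hd, mem_endComponent_iff hd']
    simp only [hφ, hrepr]
    -- The degrees of matrix units are only known to agree on `ρ`; entries outside `ρ` vanish.
    have hle : ∀ i j, v.repr (f.1 (v (π j))) (π i) ≠ 0 → ρ.le i j := fun i j hij =>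
      (hπ i j).1 ((mem_endAlg_iff hv _).1 f.2 _ _ hij)
    constructor
    · intro hf i j hij
      rw [← mul_inv_eq_iff_eq_mul, hh i j (hle i j hij), mul_inv_eq_iff_eq_mul]
      exact hf _ _ hij
    · intro hf i j hij
      obtain ⟨i, rfl⟩ := π.surjective i
      obtain ⟨j, rfl⟩ := π.surjective j
      rw [← mul_inv_eq_iff_eq_mul, ← hh i j (hle i j hij), mul_inv_eq_iff_eq_mul]
      exact hf _ _ hij

theorem ClassPerm.app_injective (ψ : ClassPerm ρ) : Function.Injective ψ.app := by
  intro i j hij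
  rw [← ClassPerm.one_app (ρ := ρ) i, ← ClassPerm.one_app (ρ := ρ) j, ← inv_mul_cancel ψ,
    ClassPerm.mul_app, ClassPerm.mul_app, hij]

instance : Finite (Classes ρ) :=
  Finite.of_surjective (cls ρ) Quotient.mk_surjective

/-- In a finite poset `≤` is the reflexive transitive closure of covering. This links `ρ` to the
components, which are defined by covering pairs. -/
theorem eq_of_le_of_forall_covBy {X : Type*} (f : Classes ρ → X)
    (hf : ∀ α β, α ⋖ β → f α = f β) {α β : Classes ρ} (hαβ : α ≤ β) : f α = f β := by
  classical
  let _ := Fintype.ofFinite (Classes ρ)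
  let _ : LocallyFiniteOrder (Classes ρ) := Fintype.toLocallyFiniteOrder
  rw [le_iff_reflTransGen_covBy] at hαβ
  induction hαβ with
  | refl => rfl
  | tail _ hcov ih => rw [ih, hf _ _ hcov]

theorem comp_eq_of_le {α β : Classes ρ} (hαβ : α ≤ β) : comp α = comp β :=
  eq_of_le_of_forall_covBy comp
    (fun _ _ h => SimpleGraph.ConnectedComponent.sound (SimpleGraph.Adj.reachable (Or.inl h))) hαβ

/-- Related indices lie in one component, so the shift cancels in `h i * (h j)⁻¹`; the rest of the
action is a permutation preserving `ρ`. -/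
theorem GradedFlag.endIsomorphic_of_mem_orbit {F : GradedFlag ρ G k V}
    {F' : GradedFlag ρ G k V'} {h h' : Fin n → G} (hF : F.IsDegreeTuple h)
    (hF' : F'.IsDegreeTuple h') (ho : h' ∈ MulAction.orbit (DoubleProduct ρ G)ᵐᵒᵖ h) :
    F.EndIsomorphic F' := by
  obtain ⟨v, hv, hd⟩ := hF
  obtain ⟨v', hv', hd'⟩ := hF'
  obtain ⟨x, rfl⟩ := ho
  set ψ := x.unop.left
  set g := x.unop.right.left
  set σ := x.unop.right.right
  have hact : ∀ i, (x • h) i = h (ψ.app (tilde ρ g i)) * σ (comp (cls ρ i)) := fun i => rfl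
  refine GradedFlag.endIsomorphic_of_perm hv hd hv' hd'
    (Equiv.ofBijective (fun i => ψ.app (tilde ρ g i))
      (Finite.injective_iff_bijective.1 (ψ.app_injective.comp (tilde ρ g).injective))) ?_ ?_
  · intro i j
    rw [← cls_le_cls, ← cls_le_cls]
    simp [ClassPerm.cls_app, cls_tilde]
  · intro i j hij
    change (x • h) i * ((x • h) j)⁻¹ = _
    rw [hact, hact, comp_eq_of_le ((cls_le_cls ρ i j).2 hij)]
    simp

end Conjugation

/-! ### Comparing two bases with the same matrix algebra -/

section Permutation

variable {k : Type*} [Field k] {n : ℕ} {ρ : Preorder (Fin n)}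
  {V : Type*} [AddCommGroup V] [Module k V]

/-- The change of basis matrix has nonzero determinant, so some term of its Leibniz expansion has no
zero factor. -/
theorem exists_perm_repr_ne_zero (v w : Module.Basis (Fin n) k V) :
    ∃ π : Equiv.Perm (Fin n), ∀ i, v.repr (w i) (π i) ≠ 0 := by
  by_contra! hzero
  have hdet : (v.toMatrix w).det = 0 := by
    rw [Matrix.det_apply]
    refine Finset.sum_eq_zero fun π _ => ?_
    obtain ⟨i, hi⟩ := hzero π
    rw [Finset.prod_eq_zero (Finset.mem_univ i) (by rwa [Module.Basis.toMatrix_apply]), smul_zero]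
  have hone := congrArg Matrix.det (v.toMatrix_mul_toMatrix_flip w)
  rw [Matrix.det_mul, hdet, zero_mul, Matrix.det_one] at hone
  exact zero_ne_one hone

/-- A map of the indices that preserves and reflects the preorder induces an automorphism of the
poset of classes. -/
theorem exists_orderIso_of_relabelling (μ : Fin n → Fin n)
    (hμ : ∀ i j, ρ.le (μ i) (μ j) ↔ ρ.le i j) :
    ∃ e : Classes ρ ≃o Classes ρ, ∀ i, e (cls ρ i) = cls ρ (μ i) := by
  have hsurj : Function.Surjective (cls ρ) := Quotient.mk_surjective
  have hinv : ∀ α, cls ρ (Function.surjInv hsurj α) = α := Function.surjInv_eq hsurj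
  let e : Classes ρ ↪o Classes ρ := OrderEmbedding.ofMapLEIff
    (fun α => cls ρ (μ (Function.surjInv hsurj α))) (by
      intro α β
      rw [cls_le_cls, hμ, ← cls_le_cls, hinv, hinv])
  refine ⟨RelIso.ofSurjective e (Finite.injective_iff_surjective.1 e.injective), fun i => ?_⟩
  apply le_antisymm
  · exact (cls_le_cls _ _ _).2 ((hμ _ _).2 ((cls_le_cls _ _ _).1 (hinv _).le))
  · exact (cls_le_cls _ _ _).2 ((hμ _ _).2 ((cls_le_cls _ _ _).1 (hinv _).ge))

/-- If a relabelling of the indices embeds the preorder into itself, then a permutation that lies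
below it pointwise is an automorphism of the preorder. -/
theorem le_perm_iff_of_le (μ : Fin n → Fin n) (hμ : ∀ i j, ρ.le (μ i) (μ j) ↔ ρ.le i j)
    (π : Equiv.Perm (Fin n)) (hπ : ∀ i, ρ.le (π i) (μ i)) (i j : Fin n) :
    ρ.le (π i) (π j) ↔ ρ.le i j := by
  obtain ⟨e, he⟩ := exists_orderIso_of_relabelling μ hμ
  -- The size of the down-set is strictly monotone and invariant under `e`. Summed over all indices,
  -- it takes the same value along `π` and along `e`, so every inequality `cls (π i) ≤ e (cls i)` is
  -- an equality.
  let r : Classes ρ → ℕ := fun α => (Set.Iic α).ncard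
  have hre : ∀ α, r (e α) = r α := by
    intro α
    have himage : e '' Set.Iic α = Set.Iic (e α) := by
      ext β
      obtain ⟨β, rfl⟩ := e.surjective β
      simp
    change (Set.Iic (e α)).ncard = _
    rw [← himage, Set.ncard_image_of_injective _ e.injective]
  have hrmono : ∀ α β : Classes ρ, α < β → r α < r β := fun α β hαβ =>
    Set.ncard_lt_ncard (Set.Iic_ssubset_Iic.2 hαβ)
  have hle : ∀ i, cls ρ (π i) ≤ e (cls ρ i) := fun i => by
    rw [he]
    exact (cls_le_cls _ _ _).2 (hπ i)
  have hsum : ∑ i, r (cls ρ (π i)) = ∑ i, r (e (cls ρ i)) := by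
    simp only [hre]
    exact Equiv.sum_comp π fun i => r (cls ρ i)
  have hrle : ∀ i ∈ Finset.univ, r (cls ρ (π i)) ≤ r (e (cls ρ i)) := fun i _ =>
    Set.ncard_le_ncard (Set.Iic_subset_Iic.2 (hle i))
  have hreq := (Finset.sum_eq_sum_iff_of_le hrle).1 hsum
  have heq : ∀ i, cls ρ (π i) = e (cls ρ i) := fun i =>
    (hle i).eq_of_not_lt fun hlt => (hrmono _ _ hlt).ne (hreq i (Finset.mem_univ i))
  rw [← cls_le_cls, heq, heq, e.le_iff_le, cls_le_cls]

/-- Two bases for which the same algebra of endomorphisms is the algebra of matrices supported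
on `ρ` have the same index preorder, up to a permutation along which they are related. -/
theorem exists_perm_of_support_eq (A : Subalgebra k (Module.End k V))
    (v w : Module.Basis (Fin n) k V)
    (hv : ∀ f ∈ A, ∀ i j, v.repr (f (v j)) i ≠ 0 → ρ.le i j)
    (hvu : ∀ i j, ρ.le i j → matrixUnit v i j ∈ A)
    (hw : ∀ f ∈ A, ∀ i j, w.repr (f (w j)) i ≠ 0 → ρ.le i j)
    (hwu : ∀ i j, ρ.le i j → matrixUnit w i j ∈ A) :
    ∃ π : Equiv.Perm (Fin n), (∀ i, v.repr (w i) (π i) ≠ 0) ∧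
      ∀ i j, ρ.le (π i) (π j) ↔ ρ.le i j := by
  -- The vectors `w i` and `v j` generate the same `A`-submodule of `V`, and inclusion of these
  -- cyclic submodules recovers `ρ` for either basis. The resulting choice `μ` may fail to be
  -- injective inside a class, hence the separate permutation `π` below it.
  have hex : ∀ i, ∃ j, (∃ f ∈ A, f (w i) = v j) ∧ ∃ f ∈ A, f (v j) = w i := by
    intro i
    have hsum : ∑ j, v.repr (w i) j * w.repr (v j) i = 1 := by
      have h1 := congrArg (w.coord i) (v.sum_repr (w i))
      rw [map_sum] at h1
      simpa only [map_smul, Module.Basis.coord_apply, smul_eq_mul, w.repr_self,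
        Finsupp.single_eq_same] using h1
    -- Both coordinates in a nonzero summand are nonzero, so rescaled diagonal units carry `w i` to
    -- `v j` and back.
    obtain ⟨j, -, hj⟩ := Finset.exists_ne_zero_of_sum_ne_zero (hsum.trans_ne one_ne_zero)
    refine ⟨j, ⟨(v.repr (w i) j)⁻¹ • matrixUnit v j j, A.smul_mem (hvu j j (ρ.le_refl j)) _, ?_⟩,
      ⟨(w.repr (v j) i)⁻¹ • matrixUnit w i i, A.smul_mem (hwu i i (ρ.le_refl i)) _, ?_⟩⟩
    · simp [smul_smul, inv_mul_cancel₀ (left_ne_zero_of_mul hj)]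
    · simp [smul_smul, inv_mul_cancel₀ (right_ne_zero_of_mul hj)]
  choose μ hμ using hex
  have hμle : ∀ i j, ρ.le (μ i) (μ j) ↔ ρ.le i j := by
    intro i j
    obtain ⟨⟨f, hf, hfi⟩, ⟨f', hf', hfi'⟩⟩ := hμ i
    obtain ⟨⟨g, hg, hgj⟩, ⟨g', hg', hgj'⟩⟩ := hμ j
    constructor
    · intro hij
      -- The product sends `w j` to `v (μ j)`, then to `v (μ i)`, then to `w i`.
      refine hw _ (A.mul_mem (A.mul_mem hf' (hvu _ _ hij)) hg) i j ?_
      simp [hgj, hfi']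
    · intro hij
      refine hv _ (A.mul_mem (A.mul_mem hf (hwu _ _ hij)) hg') _ _ ?_
      simp [hgj', hfi]
  obtain ⟨π, hπ⟩ := exists_perm_repr_ne_zero v w
  refine ⟨π, hπ, le_perm_iff_of_le μ hμle π fun i => ?_⟩
  obtain ⟨-, ⟨f, hf, hfi⟩⟩ := hμ i
  exact hv f hf _ _ (by rw [hfi]; exact hπ i)

end Permutation

/-! ### Transporting matrix units through a graded isomorphism -/

section Transport

variable {k : Type*} [Field k] {G : Type*} [Group G] {n : ℕ} {ρ : Preorder (Fin n)}
  {V V' : Type*} [AddCommGroup V] [Module k V] [AddCommGroup V'] [Module k V']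

/-- Orthogonal nonzero idempotents of degree one, as many as the dimension, are the diagonal
matrix units of a homogeneous basis. -/
theorem exists_basis_of_idempotents {F : GradedFlag ρ G k V} {v : Module.Basis (Fin n) k V}
    {h : Fin n → G} (hd : ∀ i, v i ∈ F.component (h i)) (P : Fin n → F.toFlag.endAlg)
    (hP : ∀ i, P i ∈ F.endComponent 1) (hne : ∀ i, P i ≠ 0) (hidem : ∀ i, P i * P i = P i)
    (horth : ∀ i j, i ≠ j → P i * P j = 0) :
    ∃ (w : Module.Basis (Fin n) k V) (d : Fin n → G),
      (∀ i, w i ∈ F.component (d i)) ∧ ∀ i, (P i).1 = matrixUnit w i i := by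
  have hex : ∀ i, ∃ j, (P i).1 (v j) ≠ 0 := by
    intro i
    by_contra! hz
    exact hne i (Subtype.ext (v.ext hz))
  choose τ hτ using hex
  -- A nonzero vector in the image of each idempotent. It keeps the degree of `v (τ i)` because `P
  -- i` has degree one.
  let w : Fin n → V := fun i => (P i).1 (v (τ i))
  have hself : ∀ i, (P i).1 (w i) = w i := fun i =>
    LinearMap.congr_fun (congrArg Subtype.val (hidem i)) (v (τ i))
  have hother : ∀ i j, i ≠ j → (P i).1 (w j) = 0 := fun i j hij =>
    LinearMap.congr_fun (congrArg Subtype.val (horth i j hij)) (v (τ j))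
  have hli : LinearIndependent k w := by
    rw [Fintype.linearIndependent_iff]
    intro c hc i
    have h1 := congrArg (P i).1 hc
    rw [map_sum, map_zero, Finset.sum_eq_single i] at h1
    · rw [map_smul, hself] at h1
      exact (smul_eq_zero.1 h1).resolve_right (hτ i)
    · intro j _ hj
      rw [map_smul, hother i j hj.symm, smul_zero]
    · simp
  have : FiniteDimensional k V := v.finiteDimensional_of_finite
  let b := basisOfLinearIndependentOfCardEqFinrank' w hli
    (Module.finrank_eq_card_basis v).symm
  have hb : ∀ i, b i = w i := fun i => by simp [b]
  refine ⟨b, h ∘ τ, fun i => ?_, fun i => b.ext fun j => ?_⟩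
  · have := hP i _ _ (hd (τ i))
    rw [one_mul] at this
    rw [hb]
    exact this
  · by_cases hij : i = j
    · subst hij
      rw [matrixUnit_apply_basis, hb, hself]
    · rw [hb, hother i j hij, ← hb, matrixUnit_apply, b.repr_self, Finsupp.single_apply,
        if_neg (Ne.symm hij), zero_smul]

/-- The images of the diagonal units produce `w`. Nothing says that `w` is adapted to the flag of
`F'`; only the shape of `END(F')` in `w` is obtained, and this suffices for
`exists_perm_of_support_eq`. -/
theorem GradedFlag.exists_basis_of_algEquiv {F : GradedFlag ρ G k V} {F' : GradedFlag ρ G k V'}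
    {v : Module.Basis (Fin n) k V} {v' : Module.Basis (Fin n) k V'} {h h' : Fin n → G}
    (hv : IsFlagBasis F.space v) (hd : ∀ i, v i ∈ F.component (h i))
    (hd' : ∀ i, v' i ∈ F'.component (h' i))
    (φ : F.toFlag.endAlg ≃ₐ[k] F'.toFlag.endAlg)
    (hφ : ∀ σ, ∀ f ∈ F.endComponent σ, φ f ∈ F'.endComponent σ) :
    ∃ (w : Module.Basis (Fin n) k V') (d : Fin n → G),
      (∀ i, w i ∈ F'.component (d i)) ∧
      (∀ f ∈ F'.toFlag.endAlg, ∀ i j, w.repr (f (w j)) i ≠ 0 → ρ.le i j) ∧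
      (∀ i j, ρ.le i j → matrixUnit w i j ∈ F'.toFlag.endAlg) ∧
      ∀ i j, ρ.le i j → (h i)⁻¹ * d i = (h j)⁻¹ * d j := by
  let E : ∀ i j, ρ.le i j → F.toFlag.endAlg := fun i j hij =>
    ⟨matrixUnit v i j, matrixUnit_mem_endAlg hv hij⟩
  have hEne : ∀ i j hij, φ (E i j hij) ≠ 0 := fun i j hij h0 =>
    matrixUnit_ne_zero v i j (congrArg Subtype.val ((map_eq_zero_iff φ φ.injective).1 h0))
  have hE : ∀ i j hij, φ (E i j hij) ∈ F'.endComponent (h i * (h j)⁻¹) := fun i j hij =>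
    hφ _ _ (matrixUnit_mem_endComponent hv hd hij)
  obtain ⟨w, d, hw, hP⟩ := exists_basis_of_idempotents hd' (fun i => φ (E i i (ρ.le_refl i)))
    (fun i => by simpa using hE i i (ρ.le_refl i)) (fun i => hEne i i (ρ.le_refl i))
    (fun i => by
      rw [← map_mul]
      refine congrArg φ (Subtype.ext ?_)
      ext x
      simp [E])
    (fun i j hij => by
      rw [← map_mul, map_eq_zero_iff φ φ.injective]
      refine Subtype.ext ?_
      ext x
      simp [E, Ne.symm hij])
  -- Since `φ` turns the diagonal units of `v` into those of `w`, it maps the compression of `a` at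
  -- `(i, j)` to that of `φ a`.
  have hcorner : ∀ (a : F.toFlag.endAlg) (i j : Fin n) (b : F.toFlag.endAlg),
      b.1 = v.repr (a.1 (v j)) i • matrixUnit v i j →
      (φ b).1 = w.repr ((φ a).1 (w j)) i • matrixUnit w i j := by
    intro a i j b hb
    rw [← matrixUnit_mul_mul_matrixUnit, ← hP, ← hP, ← Subalgebra.coe_mul, ← Subalgebra.coe_mul,
      ← map_mul, ← map_mul]
    refine congrArg (fun x => (φ x).1) (Subtype.ext ?_)
    rw [hb, ← matrixUnit_mul_mul_matrixUnit]
    rfl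
  have hunit : ∀ i j hij, ∃ c : k, c ≠ 0 ∧ (φ (E i j hij)).1 = c • matrixUnit w i j := by
    intro i j hij
    have h1 := hcorner (E i j hij) i j (E i j hij) (by simp [E])
    refine ⟨_, fun h0 => hEne i j hij (Subtype.ext ?_), h1⟩
    rw [h1, h0, zero_smul]
    rfl
  refine ⟨w, d, hw, fun f hf i j hij => ?_, fun i j hij => ?_, fun i j hij => ?_⟩
  · by_contra hle
    obtain ⟨a, ha⟩ := φ.surjective ⟨f, hf⟩
    have ha0 : v.repr (a.1 (v j)) i = 0 := by
      by_contra hne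
      exact hle ((mem_endAlg_iff hv _).1 a.2 i j hne)
    -- Outside `ρ` the compression of `a` is zero, hence so is that of `f`.
    have h1 := hcorner a i j 0 (by rw [ha0, zero_smul]; rfl)
    rw [map_zero, ha] at h1
    exact (smul_ne_zero hij (matrixUnit_ne_zero w i j)) h1.symm
  · obtain ⟨c, hc, hcu⟩ := hunit i j hij
    rw [← inv_smul_smul₀ hc (matrixUnit w i j), ← hcu]
    exact Subalgebra.smul_mem _ (φ (E i j hij)).2 _
  · obtain ⟨c, hc, hcu⟩ := hunit i j hij
    have h1 := (mem_endComponent_iff hw _ _).1 (hE i j hij) i j (by simpa [hcu] using hc)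
    rw [h1]
    group

/-! ### From relabelled degrees to the orbit -/

/-- A function of the indices that is constant along the preorder factors through the
connected components. -/
theorem exists_component_function {X : Type*} (f : Fin n → X)
    (hf : ∀ i j, ρ.le i j → f i = f j) :
    ∃ S : Components ρ → X, ∀ i, S (comp (cls ρ i)) = f i := by
  have hsurj : Function.Surjective (cls ρ) := Quotient.mk_surjective
  let s : Classes ρ → X := fun α => f (Function.surjInv hsurj α)
  have hle : ∀ α β, α ≤ β → s α = s β := by
    intro α β hαβ
    refine hf _ _ ?_
    rwa [← cls_le_cls, Function.surjInv_eq hsurj, Function.surjInv_eq hsurj]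
  have hwalk : ∀ α β (p : (SimpleGraph.hasse (Classes ρ)).Walk α β), s α = s β := by
    intro α β p
    induction p with
    | nil => rfl
    | cons hadj _ ih =>
      refine Eq.trans ?_ ih
      rcases hadj with hcov | hcov
      · exact hle _ _ hcov.le
      · exact (hle _ _ hcov.le).symm
  refine ⟨SimpleGraph.ConnectedComponent.lift s fun α β p _ => hwalk α β p, fun i => ?_⟩
  refine hf _ _ ?_
  rw [← cls_le_cls, Function.surjInv_eq hsurj]

/-- A permutation of the indices that is an automorphism of the preorder is the product of the
permutation attached to an element of `Aut₀(C)` and of permutations of the classes. -/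
theorem exists_app_tilde_eq (π : Equiv.Perm (Fin n))
    (hπ : ∀ i j, ρ.le (π i) (π j) ↔ ρ.le i j) :
    ∃ (ψ : ClassPerm ρ) (g : Aut0 ρ), ∀ i, ψ.app (tilde ρ g i) = π i := by
  obtain ⟨e, he⟩ := exists_orderIso_of_relabelling π hπ
  have hcard : e ∈ Aut0 ρ := by
    intro α
    have hmap : members (e α) = (members α).map π.toEmbedding := by
      ext i
      obtain ⟨i, rfl⟩ := π.surjective i
      simp [mem_members, ← he]
    rw [classCard, hmap, Finset.card_map, classCard]
  let g : Aut0 ρ := ⟨e, hcard⟩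
  -- `π` and `g̃` induce the same map on classes, so `π g̃⁻¹` preserves each class and restricts to
  -- the required `ψ`.
  let θ : Equiv.Perm (Fin n) := (tilde ρ g).symm.trans π
  have hθ : ∀ i, cls ρ (θ i) = cls ρ i := by
    intro i
    obtain ⟨i, rfl⟩ := (tilde ρ g).surjective i
    rw [cls_tilde, Equiv.trans_apply, Equiv.symm_apply_apply]
    exact (he i).symm
  refine ⟨fun α => θ.subtypePerm fun i => by rw [hθ], g, fun i => ?_⟩
  change θ (tilde ρ g i) = π i
  rw [Equiv.trans_apply, Equiv.symm_apply_apply]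

theorem mem_orbit_of_perm {h h' d : Fin n → G} (π : Equiv.Perm (Fin n))
    (hπ : ∀ i j, ρ.le (π i) (π j) ↔ ρ.le i j) (hh : ∀ i, h' i = d (π i))
    (hd : ∀ i j, ρ.le i j → (h i)⁻¹ * d i = (h j)⁻¹ * d j) :
    h' ∈ MulAction.orbit (DoubleProduct ρ G)ᵐᵒᵖ h := by
  obtain ⟨S, hS⟩ := exists_component_function _ hd
  obtain ⟨ψ, g, hψ⟩ := exists_app_tilde_eq π hπ
  -- The factor `S` is needed at the component of `π i`, while the shift is applied at the component
  -- of `i`; `g` carries the latter to the former.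
  refine ⟨MulOpposite.op ⟨ψ, ⟨g, fun t => S (compMap g t)⟩⟩, funext fun i => ?_⟩
  change h (ψ.app (tilde ρ g i)) * S (compMap g (comp (cls ρ i))) = h' i
  rw [compMap_comp, ← cls_tilde, ← ClassPerm.cls_app ψ, hψ, hS, hh, mul_inv_cancel_left]

theorem GradedFlag.mem_orbit_of_endIsomorphic {F : GradedFlag ρ G k V}
    {F' : GradedFlag ρ G k V'} {h h' : Fin n → G} (hF : F.IsDegreeTuple h)
    (hF' : F'.IsDegreeTuple h') (hiso : F.EndIsomorphic F') :
    h' ∈ MulAction.orbit (DoubleProduct ρ G)ᵐᵒᵖ h := by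
  obtain ⟨v, hv, hd⟩ := hF
  obtain ⟨v', hv', hd'⟩ := hF'
  obtain ⟨φ, hφ⟩ := hiso
  obtain ⟨w, d, hw, hws, hwu, hwd⟩ := GradedFlag.exists_basis_of_algEquiv hv hd hd' φ
    fun σ f hf => by
      rw [← hφ σ]
      exact ⟨f, hf, rfl⟩
  obtain ⟨π, hπ, hπle⟩ := exists_perm_of_support_eq F'.toFlag.endAlg v' w
    (fun f hf => (mem_endAlg_iff hv' f).1 hf) (fun i j hij => matrixUnit_mem_endAlg hv' hij) hws hwu
  refine mem_orbit_of_perm π.symm (fun i j => ?_) (fun i => ?_) hwd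
  · rw [← hπle, Equiv.apply_symm_apply, Equiv.apply_symm_apply]
  -- The vector `w i` is homogeneous of degree `d i` and has a nonzero coordinate at `v' (π i)`, so
  -- `h' (π i) = d i`.
  · have h1 := (mem_component_iff hd' _ _).1 (hw (π.symm i)) (π (π.symm i)) (hπ _)
    rwa [Equiv.apply_symm_apply] at h1

end Transport

end RhoFlag

theorem mainTheorem1 {k : Type*} [Field k] {G : Type*} [Group G] {n : ℕ}
    (ρ : Preorder (Fin n)) :
    (∀ (V : Type*) [AddCommGroup V] [Module k V] (V' : Type*) [AddCommGroup V'] [Module k V']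
        (F : GradedFlag ρ G k V) (F' : GradedFlag ρ G k V') (h h' : Fin n → G),
        F.IsDegreeTuple h → F'.IsDegreeTuple h' →
          (F.EndIsomorphic F' ↔ h' ∈ MulAction.orbit (DoubleProduct ρ G)ᵐᵒᵖ h)) ∧
      (∀ (V : Type*) [AddCommGroup V] [Module k V] (F : GradedFlag ρ G k V),
        ∃ h : Fin n → G, F.IsDegreeTuple h) ∧
      (∀ h : Fin n → G, ∃ F : GradedFlag ρ G k (Fin n → k), F.IsDegreeTuple h) :=
  ⟨fun _ _ _ _ _ _ _ _ _ _ hF hF' =>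
      ⟨GradedFlag.mem_orbit_of_endIsomorphic hF hF', GradedFlag.endIsomorphic_of_mem_orbit hF hF'⟩,
    fun _ _ _ F => F.exists_isDegreeTuple,
    fun h => ⟨GradedFlag.ofBasis ρ (Pi.basisFun k (Fin n)) h,
      GradedFlag.ofBasis_isDegreeTuple _ h⟩⟩
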